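/- Let $V$ be a Euclidean Jordan algebra: a finite-dimensional real inner product space with a commutative bilinear product $\circ$ that has a unit $e$ and satisfies $(x\circ y)\circ x^2=x\circ(y\circ x^2)$ and $\langle x\circ y,z\rangle=\langle y,x\circ z\rangle$ for all $x,y,z\in V$, where $x^2=x\circ x$. Let $n$ be its rank, that is, the maximum over $x\in V$ of the least $k$ such that $e,x,\dots,x^k$ are linearly dependent. A Jordan frame is a family $e_1,\dots,e_n$ of primitive idempotents (nonzero idempotents that are not the sum of two nonzero idempotents) with $e_i\circ e_j=0$ for $i\ne j$ and $e_1+\dots+e_n=e$. Every $x\in V$ can be written as $x=q_1e_1+\dots+q_ne_n$ with $(e_1,\dots,e_n)$ a Jordan frame and real numbers $q_1\ge q_2\ge\dots\ge q_n$, and the $q_i$ are uniquely determined by $x$; let $\lambda:V\to\mathbb R^n$ be the eigenvalue map $\lambda(x)=(q_1,\dots,q_n)$. For $q\in\mathbb R^n$ let $q^\downarrow$ denote the vector with the entries of $q$ rearranged in decreasing order, and for $S\subseteq\mathbb R^n$ let $S^\downarrow=\{q^\downarrow:q\in S\}$. A set $Q\subseteq\mathbb R^n$ is permutation invariant if it is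 nonempty and $\sigma(Q)=Q$ for every permutation $\sigma$ of the coordinates. A set is connected if it is not the union of two nonempty separated sets, and arcwise connected if any two of its points can be joined by a continuous path inside the set (so the empty set is both). Proposition. Let $P\subseteq\mathbb R^n$. If $\lambda^{-1}(P)$ is connected (respectively, arcwise connected) in $V$, then $P\cap P^\downarrow$ is connected (respectively, arcwise connected) in $\mathbb R^n$. In particular, if $Q\subseteq\mathbb R^n$ is permutation invariant and $\lambda^{-1}(Q)$ is connected (respectively, arcwise connected) in $V$, then $Q^\downarrow$ is connected (respectively, arcwise connected) in $\mathbb R^n$. -/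

import Mathlib

open scoped InnerProductSpace

/-- A Euclidean Jordan algebra: a finite-dimensional real inner product space with a commutative
bilinear product `x * y` that has a unit, satisfies the Jordan identity
`(a * b) * (a * a) = a * (b * (a * a))` (this is `IsCommJordan`), and for which the inner product is
associative. The zero algebra is allowed. -/
class EuclideanJordanAlgebra (V : Type*) extends NormedAddCommGroup V, InnerProductSpace ℝ V,
    NonAssocCommRing V, IsCommJordan V where
  finiteDimensional : FiniteDimensional ℝ V
  smul_mul : ∀ (r : ℝ) (x y : V), (r • x) * y = r • (x * y)
  inner_mul_left : ∀ x y z : V, ⟪x * y, z⟫_ℝ = ⟪y, x * z⟫_ℝ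

attribute [instance] EuclideanJordanAlgebra.finiteDimensional

namespace EuclideanJordanAlgebra

/-- The powers `1, x, x * x, x * (x * x), …` of an element for the Jordan product. -/
def jpow {V : Type*} [EuclideanJordanAlgebra V] (x : V) : ℕ → V
  | 0 => 1
  | k + 1 => x * jpow x k

/-- The degree of `x` (the degree of its minimal polynomial): the least `k` such that
`1, x, …, x ^ k` are linearly dependent. -/
noncomputable def degree {V : Type*} [EuclideanJordanAlgebra V] (x : V) : ℕ :=
  sInf {k : ℕ | ¬ LinearIndependent ℝ (fun i : Fin (k + 1) => jpow x i)}

theorem not_linearIndependent_jpow {V : Type*} [EuclideanJordanAlgebra V] (x : V) :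
    ¬ LinearIndependent ℝ (fun i : Fin (Module.finrank ℝ V + 1) => jpow x i) := by
  intro h
  have := h.fintype_card_le_finrank
  simp at this

theorem degree_le_finrank {V : Type*} [EuclideanJordanAlgebra V] (x : V) :
    degree x ≤ Module.finrank ℝ V :=
  Nat.sInf_le (not_linearIndependent_jpow x)

theorem bddAbove_range_degree (V : Type*) [EuclideanJordanAlgebra V] :
    BddAbove (Set.range (degree : V → ℕ)) :=
  ⟨Module.finrank ℝ V, by rintro _ ⟨x, rfl⟩; exact degree_le_finrank x⟩

/-- The rank of a Euclidean Jordan algebra: the maximal degree of its elements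
(the degrees are bounded by the dimension). -/
noncomputable def rank (V : Type*) [EuclideanJordanAlgebra V] : ℕ :=
  ⨆ x : V, degree x

/-- A primitive idempotent: a nonzero idempotent that is not the sum of two nonzero idempotents. -/
def IsPrimitiveIdempotent {V : Type*} [EuclideanJordanAlgebra V] (c : V) : Prop :=
  IsIdempotentElem c ∧ c ≠ 0 ∧
    ∀ a b : V, IsIdempotentElem a → IsIdempotentElem b → a + b = c → a = 0 ∨ b = 0

/-- A (listed) Jordan frame `e₁, …, eₙ`, where `n` is the rank: primitive idempotents that are
pairwise orthogonal for the Jordan product and that sum to the unit. -/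
structure IsJordanFrame {V : Type*} [EuclideanJordanAlgebra V] (e : Fin (rank V) → V) : Prop where
  primitive : ∀ i, IsPrimitiveIdempotent (e i)
  mul_eq_zero : ∀ i j, i ≠ j → e i * e j = 0
  sum_eq_one : ∑ i, e i = 1

/-- `q` lists the eigenvalues of `x` in decreasing order: `q₁ ≥ ⋯ ≥ qₙ` and
`x = q₁ e₁ + ⋯ + qₙ eₙ` for some Jordan frame. -/
def IsEigenvalueVector {V : Type*} [EuclideanJordanAlgebra V] (x : V)
    (q : EuclideanSpace ℝ (Fin (rank V))) : Prop :=
  (∀ i j, i ≤ j → q j ≤ q i) ∧ ∃ e : Fin (rank V) → V, IsJordanFrame e ∧ x = ∑ i, q i • e i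

open Classical in
/-- The eigenvalue map `λ`: it takes `x` to the vector of its eigenvalues in decreasing order.
By the spectral theorem every `x` has exactly one such vector, so the value `0` of the second
branch is never used and nothing depends on the choice. -/
noncomputable def eigenvalueMap {V : Type*} [EuclideanJordanAlgebra V] (x : V) :
    EuclideanSpace ℝ (Fin (rank V)) :=
  if h : ∃ q, IsEigenvalueVector x q then h.choose else 0

end EuclideanJordanAlgebra

/-- The vector `(q_{σ(1)}, …, q_{σ(n)})`. -/
noncomputable def permuteVec {n : ℕ} (σ : Equiv.Perm (Fin n)) (q : EuclideanSpace ℝ (Fin n)) :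
    EuclideanSpace ℝ (Fin n) :=
  WithLp.toLp 2 (fun i => q (σ i))

/-- The decreasing rearrangement `q↓` of a vector `q` (`Tuple.sort f` is a permutation `σ` for which
`f ∘ σ` is monotone). -/
noncomputable def decreasingRearrangement {n : ℕ} (q : EuclideanSpace ℝ (Fin n)) :
    EuclideanSpace ℝ (Fin n) :=
  permuteVec (Tuple.sort (fun i => -q i)) q

theorem decreasingRearrangement_antitone {n : ℕ} (q : EuclideanSpace ℝ (Fin n)) (i j : Fin n)
    (h : i ≤ j) : decreasingRearrangement q j ≤ decreasingRearrangement q i := by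
  have := Tuple.monotone_sort (fun i => -q i) h
  simpa [decreasingRearrangement, permuteVec] using this

/-- `S↓ = {q↓ : q ∈ S}`. -/
noncomputable def decreasingSet {n : ℕ} (S : Set (EuclideanSpace ℝ (Fin n))) :
    Set (EuclideanSpace ℝ (Fin n)) :=
  decreasingRearrangement '' S

/-- A permutation invariant set: nonempty, and `σ(S) = S` for all permutations `σ`. -/
def IsPermutationInvariant {n : ℕ} (S : Set (EuclideanSpace ℝ (Fin n))) : Prop :=
  S.Nonempty ∧ ∀ σ : Equiv.Perm (Fin n), permuteVec σ '' S = S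

/-- Arcwise (= pathwise) connected: any two points of `S` are joined by a continuous path in `S`.
As in the convention for `IsPreconnected`, the empty set is not excluded. -/
def IsArcwiseConnected {X : Type*} [TopologicalSpace X] (S : Set X) : Prop :=
  ∀ x ∈ S, ∀ y ∈ S, JoinedIn S x y

/-!
The eigenvalue map `λ` is continuous, and its image on `λ⁻¹(P)` is exactly the set of decreasing
vectors in `P`, which is `P ∩ P↓`; connectedness and arcwise connectedness therefore pass from
`λ⁻¹(P)` to `P ∩ P↓`. For permutation invariant `Q` one has `Q↓ ⊆ Q`, so `Q ∩ Q↓ = Q↓`.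

What has to be established is the spectral theory behind `λ`.

* Power associativity (`polyEval_mul`): by the linearised Jordan identity the operators `L(xᵏ)`
  commute with `L(x)`, so `p ↦ p(L(x)) 1` is multiplicative. As `L(x)` is symmetric, Lagrange basis
  polynomials at its spectrum turn this into a decomposition of `x` along a complete system of
  orthogonal idempotents (`exists_isCompleteSystem_sum_smul`).
* Positivity (`inner_idempotent_nonneg`): multiplication by an idempotent is positive semidefinite,
  so two idempotents have nonnegative inner product, and product zero if the inner product vanishes.
  This replaces the Peirce decomposition.
* Maximality (`IsCompleteSystem.card_le_rank`): a complete system has at most `rank V` members.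
  Consequently a system with `rank V` members consists of primitive idempotents
  (`IsCompleteSystem.isJordanFrame`), and two such systems with equal partial sums have equally
  many terms in these sums (`card_le_card_of_sum_eq`). The latter gives uniqueness of the
  eigenvalues with multiplicity (`IsEigenvalueVector.unique`).
* Compactness (`isClosed_setOf_sum_smul`): the Jordan frames form a compact set and the
  coefficients are bounded by the norm of the element, so `(a, e) ↦ ∑ aᵢ eᵢ` maps sets of the form
  `C × {frames}`, with `C` closed, to closed sets. Elements of maximal degree are dense and have a
  frame, so every element has one; and the preimages under `λ` of closed sets are closed, which is
  continuity.
-/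

namespace EuclideanJordanAlgebra

open Polynomial Filter Topology

/-! ### Multiplication operators and power associativity -/

section Multiplication

variable {V : Type*} [EuclideanJordanAlgebra V]

/-- The Jordan product as a bilinear map; `lmul x` is the multiplication operator `L(x)`. -/
def lmul : V →ₗ[ℝ] V →ₗ[ℝ] V :=
  LinearMap.mk₂ ℝ (fun x y => x * y) add_mul smul_mul mul_add
    (fun r x y => by rw [mul_comm, smul_mul, mul_comm])

@[simp] theorem lmul_apply (x y : V) : lmul x y = x * y := rfl

theorem lmul_isSymmetric (x : V) : (lmul x).IsSymmetric := fun y z => inner_mul_left x y z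

/-- The Jordan product as a continuous bilinear map. -/
noncomputable def lmulCLM : V →L[ℝ] V →L[ℝ] V :=
  LinearMap.toContinuousLinearMap
    ((LinearMap.toContinuousLinearMap (𝕜 := ℝ) (E := V) (F' := V)).toLinearMap ∘ₗ lmul)

instance : ContinuousMul V where
  continuous_mul := (lmulCLM (V := V)).continuous₂

theorem norm_mul_le_opNorm (x y : V) : ‖x * y‖ ≤ ‖lmulCLM (V := V)‖ * ‖x‖ * ‖y‖ :=
  (lmulCLM (V := V)).le_opNorm₂ x y

/-- The linearised Jordan identity, read as an identity between multiplication operators. It comes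
from polarising the Jordan identity in the element `x` and regarding one of the four arguments as
the variable. -/
theorem lmul_sq_mul (x d : V) :
    lmul (x * x * d) = lmul (x * x) * lmul d - (2 : ℝ) • (lmul x * lmul d * lmul x)
      + (2 : ℝ) • (lmul (x * d) * lmul x) := by
  ext a
  simp only [LinearMap.add_apply, LinearMap.sub_apply, LinearMap.smul_apply, Module.End.mul_apply,
    lmul_apply]
  have h' : (2 : ℝ) • (a * (x * x * d) - x * x * (a * d) + (x * (x * a * d) - x * a * (x * d))
      + (x * (a * x * d) - a * x * (x * d))) = 0 := by
    rw [ofNat_smul_eq_nsmul]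
    exact congrArg (fun f : AddMonoid.End V => f d) (two_nsmul_lie_lmul_lmul_add_add_eq_zero a x x)
  have h2 := (smul_eq_zero.mp h').resolve_left two_ne_zero
  rw [mul_comm a x] at h2
  rw [mul_comm (x * x * d) a, mul_comm d a, mul_comm d (x * a), mul_comm (x * d) (x * a),
    ← sub_eq_zero, ← h2]
  module

/-- By `lmul_sq_mul`, `L(xᵏ⁺²)` is a polynomial in `L(x²)`, `L(xᵏ)`, `L(xᵏ⁺¹)` and `L(x)`, so the claim
follows by induction on `k` from the Jordan identity, the case `k = 2`. -/
theorem commute_lmul_jpow (x : V) (k : ℕ) : Commute (lmul x) (lmul (jpow x k)) := by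
  have hsq : Commute (lmul x) (lmul (x * x)) := by
    refine LinearMap.ext fun a => ?_
    have := IsCommJordan.lmul_comm_rmul_rmul x a
    simp only [Module.End.mul_apply, lmul_apply]
    rw [mul_comm (x * x) a, ← this, mul_comm (x * a)]
  have hone : Commute (lmul x) (lmul (1 : V)) := by
    refine LinearMap.ext fun a => ?_
    simp
  suffices h : ∀ k, Commute (lmul x) (lmul (jpow x k)) ∧ Commute (lmul x) (lmul (jpow x (k + 1)))
    from (h k).1
  intro k
  induction k with
  | zero => exact ⟨hone, by simp [jpow]⟩
  | succ k ih =>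
    refine ⟨ih.2, ?_⟩
    -- `x² ∘ xᵏ = xᵏ⁺²` since `L(x)` commutes with `L(xᵏ)`.
    have hk : jpow x (k + 1 + 1) = x * x * jpow x k := by
      have := LinearMap.congr_fun ih.1.eq x
      simp only [Module.End.mul_apply, lmul_apply] at this
      rw [mul_comm (x * x), ← this, jpow, jpow, mul_comm x (jpow x k)]
    rw [hk, lmul_sq_mul]
    refine ((hsq.mul_right ih.1).sub_right (Commute.smul_right ?_ _)).add_right
      (Commute.smul_right ?_ _)
    · exact ((Commute.refl _).mul_right ih.1).mul_right (Commute.refl _)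
    · exact ih.2.mul_right (Commute.refl _)

/-- The value `p(x)` of a real polynomial at `x`, encoded as `p(L(x)) 1`. -/
noncomputable def polyEval (x : V) (p : ℝ[X]) : V := aeval (lmul x) p 1

theorem polyEval_X_pow (x : V) (k : ℕ) : polyEval x (X ^ k) = jpow x k := by
  induction k with
  | zero => simp [polyEval, jpow]
  | succ k ih =>
    rw [polyEval, pow_succ', map_mul, aeval_X, Module.End.mul_apply]
    exact congrArg (lmul x) ih

theorem commute_lmul_polyEval (x : V) (p : ℝ[X]) : Commute (lmul x) (lmul (polyEval x p)) := by
  induction p using Polynomial.induction_on' with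
  | add p q hp hq =>
    have : polyEval x (p + q) = polyEval x p + polyEval x q := by simp [polyEval]
    rw [this, map_add]
    exact hp.add_right hq
  | monomial n a =>
    have : polyEval x (monomial n a) = a • jpow x n := by
      rw [← polyEval_X_pow, ← C_mul_X_pow_eq_monomial, ← smul_eq_C_mul]
      simp [polyEval]
    rw [this, map_smul]
    exact (commute_lmul_jpow x n).smul_right a

/-- Power associativity: `p ↦ p(x)` is multiplicative. -/
theorem polyEval_mul (x : V) (p q : ℝ[X]) :
    polyEval x (p * q) = polyEval x p * polyEval x q := by
  have h : Commute (aeval (lmul x) q) (lmul (polyEval x p)) :=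
    (Algebra.commute_of_mem_adjoin_singleton_of_commute
      (aeval_mem_adjoin_singleton ℝ (lmul x)) (commute_lmul_polyEval x p).symm).symm
  have := LinearMap.congr_fun h.eq 1
  simp only [Module.End.mul_apply, lmul_apply, mul_one] at this
  rw [mul_comm p q, polyEval, map_mul, Module.End.mul_apply]
  exact this

end Multiplication

/-! ### Positivity of idempotents -/

section Idempotents

variable {V : Type*} [EuclideanJordanAlgebra V] {c d : V}

/-- The multiplication operator `L` of an idempotent satisfies `2L³ - 3L² + L = 0`, so its spectrum
lies in `{0, 1/2, 1}`; on that set `t = t² + 4(t² - t)²`, which makes `L` positive semidefinite. -/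
theorem inner_idempotent_mul_self (hc : IsIdempotentElem c) (v : V) :
    ⟪c * v, v⟫_ℝ = ‖c * v‖ ^ 2 + 4 * ‖c * (c * v) - c * v‖ ^ 2 := by
  have key : ∀ w : V, c * w = (3 : ℝ) • (c * (c * w)) - (2 : ℝ) • (c * (c * (c * w))) := by
    intro w
    have h := LinearMap.congr_fun (lmul_sq_mul c c) w
    simp only [hc.eq, LinearMap.add_apply, LinearMap.sub_apply, LinearMap.smul_apply,
      Module.End.mul_apply, lmul_apply] at h
    nth_rewrite 1 [h]
    module
  have e1 : ⟪c * v, c * v⟫_ℝ = ⟪v, c * (c * v)⟫_ℝ := inner_mul_left c v _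
  have e2 : ⟪c * (c * v), c * v⟫_ℝ = ⟪v, c * (c * (c * v))⟫_ℝ := by
    rw [inner_mul_left, inner_mul_left]
  have e3 : ⟪c * (c * v), c * (c * v)⟫_ℝ = ⟪v, c * (c * (c * (c * v)))⟫_ℝ := by
    rw [inner_mul_left, inner_mul_left]
  have k1 := congrArg (fun z => ⟪v, z⟫_ℝ) (key v)
  have k2 := congrArg (fun z => ⟪v, z⟫_ℝ) (key (c * v))
  simp only [inner_sub_right, inner_smul_right] at k1 k2
  rw [← real_inner_self_eq_norm_sq, ← real_inner_self_eq_norm_sq, inner_sub_left, inner_sub_right,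
    inner_sub_right, real_inner_comm (c * (c * v)) (c * v), e1, e2, e3, real_inner_comm]
  linarith

theorem inner_idempotent_nonneg (hc : IsIdempotentElem c) (hd : IsIdempotentElem d) :
    0 ≤ ⟪c, d⟫_ℝ := by
  have h : ⟪c, d⟫_ℝ = ⟪c * d, d⟫_ℝ := by
    rw [mul_comm, inner_mul_left, hd.eq]
  rw [h, inner_idempotent_mul_self hc]
  positivity

theorem mul_eq_zero_of_inner_idempotent_eq_zero (hc : IsIdempotentElem c)
    (hd : IsIdempotentElem d) (h0 : ⟪c, d⟫_ℝ = 0) : c * d = 0 := by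
  have h : ⟪c, d⟫_ℝ = ⟪c * d, d⟫_ℝ := by
    rw [mul_comm, inner_mul_left, hd.eq]
  rw [h0, inner_idempotent_mul_self hc] at h
  have h1 : ‖c * d‖ ^ 2 = 0 := by nlinarith [sq_nonneg ‖c * d‖, sq_nonneg ‖c * (c * d) - c * d‖]
  simpa using h1

theorem inner_eq_zero_of_mul_eq_zero (h : c * d = 0) : ⟪c, d⟫_ℝ = 0 := by
  have := inner_mul_left c 1 d
  rw [mul_one, h, inner_zero_right] at this
  exact this

theorem norm_idempotent_le (hc : IsIdempotentElem c) : ‖c‖ ≤ ‖(1 : V)‖ := by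
  have h : ‖c‖ * ‖c‖ = ⟪1, c⟫_ℝ := by
    have := inner_mul_left c 1 c
    rwa [mul_one, hc.eq, real_inner_self_eq_norm_mul_norm] at this
  have h2 : ‖c‖ * ‖c‖ ≤ ‖(1 : V)‖ * ‖c‖ := h ▸ real_inner_le_norm _ _
  rcases (norm_nonneg c).eq_or_lt with h0 | h0
  · rw [← h0]; exact norm_nonneg _
  · exact le_of_mul_le_mul_right h2 h0

theorem one_le_norm_idempotent (hc : IsIdempotentElem c) (h0 : c ≠ 0) :
    1 ≤ ‖lmulCLM (V := V)‖ * ‖c‖ := by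
  have h := norm_mul_le_opNorm c c
  rw [hc.eq] at h
  exact le_of_mul_le_mul_right (by rwa [one_mul]) (norm_pos_iff.mpr h0)

theorem mul_eq_zero_of_add_isIdempotentElem (hc : IsIdempotentElem c) (hd : IsIdempotentElem d)
    (h : IsIdempotentElem (c + d)) : c * d = 0 := by
  have h1 : (c + d) * (c + d) = c + d := h
  rw [add_mul, mul_add, mul_add, hc.eq, hd.eq, mul_comm d c] at h1
  have h2 : (2 : ℝ) • (c * d) = 0 := by
    rw [two_smul, ← sub_eq_zero.mpr h1]; abel
  exact (smul_eq_zero.mp h2).resolve_left two_ne_zero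

end Idempotents

/-! ### Complete systems of orthogonal idempotents -/

/-- A complete system of orthogonal idempotents: nonzero idempotents, pairwise orthogonal for the
Jordan product, that sum to the unit. Primitivity is not required. -/
structure IsCompleteSystem {V : Type*} [EuclideanJordanAlgebra V] {ι : Type*} [Fintype ι]
    (c : ι → V) : Prop where
  idem : ∀ i, IsIdempotentElem (c i)
  ne_zero : ∀ i, c i ≠ 0
  mul_eq_zero : ∀ i j, i ≠ j → c i * c j = 0
  sum_eq_one : ∑ i, c i = 1

section CompleteSystems

variable {V : Type*} [EuclideanJordanAlgebra V] {ι κ : Type*} [Fintype ι] [Fintype κ] {c : ι → V}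

theorem IsJordanFrame.isCompleteSystem {e : Fin (rank V) → V} (he : IsJordanFrame e) :
    IsCompleteSystem e :=
  ⟨fun i => (he.primitive i).1, fun i => (he.primitive i).2.1, he.mul_eq_zero, he.sum_eq_one⟩

theorem IsCompleteSystem.comp_equiv (hc : IsCompleteSystem c) (σ : κ ≃ ι) :
    IsCompleteSystem (c ∘ σ) :=
  ⟨fun _ => hc.idem _, fun _ => hc.ne_zero _,
    fun _ _ hij => hc.mul_eq_zero _ _ (σ.injective.ne hij),
    (σ.sum_comp c).trans hc.sum_eq_one⟩

theorem IsCompleteSystem.inner_eq_zero (hc : IsCompleteSystem c) {i j : ι} (hij : i ≠ j) :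
    ⟪c i, c j⟫_ℝ = 0 :=
  inner_eq_zero_of_mul_eq_zero (hc.mul_eq_zero i j hij)

theorem IsCompleteSystem.linearIndependent (hc : IsCompleteSystem c) : LinearIndependent ℝ c :=
  linearIndependent_of_ne_zero_of_inner_eq_zero hc.ne_zero fun _ _ hij => hc.inner_eq_zero hij

theorem IsCompleteSystem.mul_sum_smul (hc : IsCompleteSystem c) (a : ι → ℝ) (i : ι) :
    c i * ∑ j, a j • c j = a i • c i := by
  classical
  rw [← lmul_apply, map_sum, Finset.sum_eq_single i]
  · simp [(hc.idem i).eq]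
  · intro j _ hj
    simp [hc.mul_eq_zero i j hj.symm]
  · simp

theorem IsCompleteSystem.polyEval_sum (hc : IsCompleteSystem c) (a : ι → ℝ) (p : ℝ[X]) :
    polyEval (∑ i, a i • c i) p = ∑ i, p.eval (a i) • c i := by
  have h : ∀ i, aeval (lmul (∑ i, a i • c i)) p (c i) = p.eval (a i) • c i := fun i =>
    Module.End.aeval_apply_of_hasEigenvector
      ⟨Module.End.mem_eigenspace_iff.mpr
        (by rw [lmul_apply, mul_comm, hc.mul_sum_smul]), hc.ne_zero i⟩
  rw [polyEval, ← hc.sum_eq_one, map_sum]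
  exact Finset.sum_congr rfl fun i _ => h i

theorem le_degree {x : V} {m : ℕ} (h : LinearIndependent ℝ fun i : Fin m => jpow x i) :
    m ≤ degree x := by
  refine le_csInf ⟨_, not_linearIndependent_jpow x⟩ fun k hk => ?_
  by_contra hlt
  exact hk (h.comp (Fin.castLE (not_le.mp hlt)) (Fin.castLE_injective _))

theorem degree_le_rank (x : V) : degree x ≤ rank V :=
  le_ciSup (bddAbove_range_degree V) x

theorem linearIndependent_jpow_of_le_degree {x : V} {m : ℕ} (h : m ≤ degree x) :
    LinearIndependent ℝ fun i : Fin m => jpow x i := by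
  cases m with
  | zero => exact linearIndependent_empty_type
  | succ k =>
    by_contra hk
    have h' : degree x ≤ k := Nat.sInf_le hk
    omega

/-- No complete system of orthogonal idempotents has more than `rank V` members: a combination
with distinct coefficients has, by Vandermonde, linearly independent powers. -/
theorem IsCompleteSystem.card_le_rank (hc : IsCompleteSystem c) : Fintype.card ι ≤ rank V := by
  let σ := (Fintype.equivFin ι).symm
  have hd := hc.comp_equiv σ
  refine le_trans (le_degree (x := ∑ i : Fin (Fintype.card ι), ((i : ℕ) : ℝ) • (c ∘ σ) i) ?_) (degree_le_rank _)
  rw [Fintype.linearIndependent_iff]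
  intro g hg
  simp_rw [← polyEval_X_pow, hd.polyEval_sum, Finset.smul_sum, smul_smul] at hg
  rw [Finset.sum_comm] at hg
  simp_rw [← Finset.sum_smul] at hg
  have h0 := Fintype.linearIndependent_iff.mp hd.linearIndependent _ hg
  refine congrFun (Matrix.eq_zero_of_forall_index_sum_mul_pow_eq_zero
    (f := fun i : Fin (Fintype.card ι) => ((i : ℕ) : ℝ)) (v := g) ?_ ?_)
  · exact fun i j hij => Fin.ext (Nat.cast_injective hij)
  · simpa using h0

/-- A complete system of `rank V` idempotents is a Jordan frame: splitting a member would give a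
complete system with too many members. -/
theorem IsCompleteSystem.isJordanFrame {e : Fin (rank V) → V} (he : IsCompleteSystem e) :
    IsJordanFrame e := by
  refine ⟨fun i => ⟨he.idem i, he.ne_zero i, fun a b ha hb hab => ?_⟩, he.mul_eq_zero,
    he.sum_eq_one⟩
  by_contra! hne
  have hmul : a * b = 0 :=
    mul_eq_zero_of_add_isIdempotentElem ha hb (hab ▸ he.idem i)
  -- `⟪a, e j⟫` and `⟪b, e j⟫` are nonnegative with sum `⟪e i, e j⟫ = 0`.
  have horth : ∀ j, j ≠ i → a * e j = 0 ∧ b * e j = 0 := by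
    intro j hj
    have h0 : ⟪a, e j⟫_ℝ + ⟪b, e j⟫_ℝ = 0 := by
      rw [← inner_add_left, hab]; exact he.inner_eq_zero hj.symm
    have h1 := inner_idempotent_nonneg ha (he.idem j)
    have h2 := inner_idempotent_nonneg hb (he.idem j)
    exact ⟨mul_eq_zero_of_inner_idempotent_eq_zero ha (he.idem j) (by linarith),
      mul_eq_zero_of_inner_idempotent_eq_zero hb (he.idem j) (by linarith)⟩
  have hs : IsCompleteSystem (fun o : Option (Fin (rank V)) =>
      o.elim b (Function.update e i a)) := by
    refine ⟨?_, ?_, ?_, ?_⟩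
    · rintro (_ | j)
      · exact hb
      · by_cases hj : j = i
        · subst hj; simpa using ha
        · simpa [hj] using he.idem j
    · rintro (_ | j)
      · exact hne.2
      · by_cases hj : j = i
        · subst hj; simpa using hne.1
        · simpa [hj] using he.ne_zero j
    · rintro (_ | j) (_ | k) hjk
      · exact absurd rfl hjk
      · by_cases hk : k = i
        · subst hk; simpa [mul_comm b a] using hmul
        · simpa [hk] using (horth k hk).2
      · by_cases hj : j = i
        · subst hj; simpa using hmul
        · simpa [hj, mul_comm _ b] using (horth j hj).2
      · have hjk' : j ≠ k := fun h => hjk (congrArg some h)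
        by_cases hj : j = i
        · subst hj; simpa [hjk'.symm] using (horth k hjk'.symm).1
        · by_cases hk : k = i
          · subst hk; simpa [hj, mul_comm _ a] using (horth j hj).1
          · simpa [hj, hk] using he.mul_eq_zero j k hjk'
    · rw [Fintype.sum_option]
      simp only [Option.elim]
      rw [Finset.sum_update_of_mem (Finset.mem_univ i), ← add_assoc, add_comm b a, hab,
        ← he.sum_eq_one, ← Finset.add_sum_erase _ e (Finset.mem_univ i),
        Finset.sdiff_singleton_eq_erase]
  have := hs.card_le_rank
  simp at this

/-- If partial sums of two complete systems of `rank V` idempotents agree, the second sum has at most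
as many terms as the first: exchanging the two sums produces a complete system again, and that has
at most `rank V` members. -/
theorem card_le_card_of_sum_eq {e f : Fin (rank V) → V} (he : IsCompleteSystem e)
    (hf : IsCompleteSystem f) {A B : Finset (Fin (rank V))}
    (h : ∑ i ∈ A, e i = ∑ j ∈ B, f j) : B.card ≤ A.card := by
  classical
  have hEe : ∀ i ∈ Aᶜ, ⟪e i, ∑ j ∈ B, f j⟫_ℝ = 0 := by
    intro i hi
    rw [← h, inner_sum]
    refine Finset.sum_eq_zero fun j hj => he.inner_eq_zero ?_
    rintro rfl
    exact Finset.mem_compl.mp hi hj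
  -- The nonnegative numbers `⟪e i, f j⟫`, `j ∈ B`, sum to zero, so each of them vanishes.
  have horth : ∀ i ∈ Aᶜ, ∀ j ∈ B, e i * f j = 0 := by
    intro i hi j hj
    have h0 := hEe i hi
    rw [inner_sum, Finset.sum_eq_zero_iff_of_nonneg
      (fun k _ => inner_idempotent_nonneg (he.idem i) (hf.idem k))] at h0
    exact mul_eq_zero_of_inner_idempotent_eq_zero (he.idem i) (hf.idem j) (h0 j hj)
  have hs : IsCompleteSystem (Sum.elim (fun i : (Aᶜ : Finset _) => e i) (fun j : B => f j)) := by
    refine ⟨?_, ?_, ?_, ?_⟩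
    · rintro (i | j)
      exacts [he.idem i, hf.idem j]
    · rintro (i | j)
      exacts [he.ne_zero i, hf.ne_zero j]
    · rintro (i | i) (j | j) hij
      · exact he.mul_eq_zero _ _ fun h => hij (congrArg _ (Subtype.ext h))
      · exact horth i i.2 j j.2
      · exact (mul_comm _ _).trans (horth j j.2 i i.2)
      · exact hf.mul_eq_zero _ _ fun h => hij (congrArg _ (Subtype.ext h))
    · rw [Fintype.sum_sum_type]
      simp only [Sum.elim_inl, Sum.elim_inr]
      rw [Finset.sum_coe_sort Aᶜ e, Finset.sum_coe_sort B f, ← h, Finset.sum_compl_add_sum,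
        he.sum_eq_one]
  have := hs.card_le_rank
  simp only [Fintype.card_sum, Fintype.card_coe, Finset.card_compl, Fintype.card_fin] at this
  have := A.card_le_univ
  simp only [Fintype.card_fin] at this
  omega

end CompleteSystems

/-! ### Spectral decomposition of a single element -/

section Spectral

variable {V : Type*} [EuclideanJordanAlgebra V]

/-- Spectral decomposition with respect to some complete system of orthogonal idempotents: the
idempotents are the nonzero values at `x` of the Lagrange basis polynomials of the spectrum of
`L(x)`. -/
theorem exists_isCompleteSystem_sum_smul (x : V) :
    ∃ (s : Finset ℝ) (c : s → V), IsCompleteSystem c ∧ x = ∑ i : s, (i : ℝ) • c i := by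
  classical
  have hT := lmul_isSymmetric x
  let b := hT.eigenvectorBasis rfl
  let μ := hT.eigenvalues rfl
  let S : Finset ℝ := Finset.univ.image μ
  -- `p(x)` depends only on the values of `p` on the spectrum `S`, as `L(x)` is diagonalisable.
  have hext : ∀ p q : ℝ[X], (∀ t ∈ S, p.eval t = q.eval t) → polyEval x p = polyEval x q := by
    intro p q hpq
    have : aeval (lmul x) p = aeval (lmul x) q := by
      refine b.toBasis.ext fun i => ?_
      have hi := hT.hasEigenvector_eigenvectorBasis rfl i
      rw [OrthonormalBasis.coe_toBasis, Module.End.aeval_apply_of_hasEigenvector hi,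
        Module.End.aeval_apply_of_hasEigenvector hi]
      exact congrArg (· • b i) (hpq _ (Finset.mem_image_of_mem _ (Finset.mem_univ i)))
    rw [polyEval, this, polyEval]
  let c : ℝ → V := fun t => polyEval x (Lagrange.basis S id t)
  have heval : ∀ t ∈ S, ∀ u ∈ S, (Lagrange.basis S (id : ℝ → ℝ) t).eval u = if t = u then 1 else 0 := by
    intro t ht u hu
    split_ifs with h
    · subst h
      exact Lagrange.eval_basis_self (v := (id : ℝ → ℝ)) Function.injective_id.injOn ht
    · exact Lagrange.eval_basis_of_ne (v := (id : ℝ → ℝ)) h hu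
  have hsum : ∀ g : ℝ → ℝ, ∀ p : ℝ[X], (∀ t ∈ S, p.eval t = g t) →
      polyEval x p = ∑ t ∈ S, g t • c t := by
    intro g p hp
    have : ∑ t ∈ S, g t • c t = polyEval x (∑ t ∈ S, g t • Lagrange.basis S id t) := by
      simp [polyEval, c, LinearMap.sum_apply]
    rw [this]
    refine hext _ _ fun u hu => ?_
    have hterm : ∀ t ∈ S, (g t • Lagrange.basis S (id : ℝ → ℝ) t).eval u
        = if t = u then g t else 0 := fun t ht => by
      rw [eval_smul, heval t ht u hu, smul_eq_mul]
      split_ifs <;> simp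
    rw [hp u hu, eval_finsetSum, Finset.sum_congr rfl hterm]
    simp [hu]
  have hmul : ∀ t ∈ S, ∀ u ∈ S, c t * c u = if t = u then c t else 0 := by
    intro t ht u hu
    rw [← polyEval_mul]
    split_ifs with h
    · subst h
      refine hext _ _ fun v hv => ?_
      rw [eval_mul, heval t ht v hv]
      split_ifs <;> simp
    · have h0 : polyEval x 0 = 0 := by simp [polyEval]
      rw [← h0]
      refine hext _ _ fun v hv => ?_
      rw [eval_mul, heval t ht v hv, heval u hu v hv]
      split_ifs with h1 h2
      · exact absurd (h1.trans h2.symm) h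
      all_goals simp
  have hS : ∀ t : (S.filter fun t => c t ≠ 0), (t : ℝ) ∈ S := fun t =>
    (Finset.mem_filter.mp t.2).1
  have hfilter : ∀ g : ℝ → ℝ, ∑ i : (S.filter fun t => c t ≠ 0), g i • c i
      = ∑ t ∈ S, g t • c t := by
    intro g
    rw [Finset.sum_coe_sort (S.filter fun t => c t ≠ 0) (fun t => g t • c t)]
    refine Finset.sum_filter_of_ne fun t _ h h0 => h (by rw [h0, smul_zero])
  refine ⟨S.filter fun t => c t ≠ 0, fun t => c t, ⟨?_, ?_, ?_, ?_⟩, ?_⟩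
  · intro t
    have := hmul t (hS t) t (hS t)
    rwa [if_pos rfl] at this
  · exact fun t => (Finset.mem_filter.mp t.2).2
  · intro t u htu
    rw [hmul t (hS t) u (hS u), if_neg fun h => htu (Subtype.ext h)]
  · have h1 := hsum (fun _ => 1) 1 (by simp)
    have h2 := hfilter fun _ => 1
    simp only [one_smul] at h1 h2
    rw [h2, ← h1]
    simp [polyEval]
  · rw [hfilter fun t => t, ← hsum (fun t => t) X (by simp)]
    simp [polyEval]

/-- An element of maximal degree is diagonalised by a Jordan frame. -/
theorem exists_isCompleteSystem_of_degree_eq {x : V} (hx : degree x = rank V) :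
    ∃ (a : Fin (rank V) → ℝ) (e : Fin (rank V) → V),
      IsCompleteSystem e ∧ x = ∑ i, a i • e i := by
  obtain ⟨s, c, hc, hxc⟩ := exists_isCompleteSystem_sum_smul x
  have hcard : Fintype.card s = rank V := by
    refine le_antisymm hc.card_le_rank ?_
    have hli := linearIndependent_jpow_of_le_degree hx.ge
    -- All powers of `x` lie in the span of the idempotents.
    have hmem : Set.range (fun i : Fin (rank V) => jpow x i)
        ⊆ Submodule.span ℝ (Set.range c) := by
      rintro _ ⟨i, rfl⟩
      change jpow x i ∈ _
      rw [← polyEval_X_pow, hxc, hc.polyEval_sum]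
      exact Submodule.sum_mem _ fun j _ =>
        Submodule.smul_mem _ _ (Submodule.subset_span ⟨j, rfl⟩)
    have h1 := Submodule.finrank_mono (Submodule.span_le.mpr hmem)
    rw [finrank_span_eq_card hli, finrank_span_eq_card hc.linearIndependent,
      Fintype.card_fin] at h1
    exact h1
  let σ := (Fintype.equivFinOfCardEq hcard).symm
  exact ⟨fun i => (σ i : ℝ), c ∘ σ, hc.comp_equiv σ,
    hxc.trans (σ.sum_comp fun t : s => (t : ℝ) • c t).symm⟩

end Spectral

/-! ### Compactness of frames, density, and the spectral theorem -/

section Existence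

variable {V : Type*} [EuclideanJordanAlgebra V] {ι : Type*} [Fintype ι]

theorem isCompact_setOf_isCompleteSystem : IsCompact {c : ι → V | IsCompleteSystem c} := by
  -- Nonzero idempotents have norm bounded below, so being nonzero is a closed condition here.
  have hset : {c : ι → V | IsCompleteSystem c} = {c : ι → V | (∀ i, c i * c i = c i) ∧
      (∀ i, 1 ≤ ‖lmulCLM (V := V)‖ * ‖c i‖) ∧ (∀ i j, i ≠ j → c i * c j = 0) ∧
      ∑ i, c i = 1} := by
    ext c
    refine ⟨fun h => ⟨h.idem, fun i => one_le_norm_idempotent (h.idem i) (h.ne_zero i),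
      h.mul_eq_zero, h.sum_eq_one⟩, fun ⟨h1, h2, h3, h4⟩ => ⟨h1, fun i h0 => ?_, h3, h4⟩⟩
    have := h2 i
    rw [h0, norm_zero, MulZeroClass.mul_zero] at this
    exact absurd this (by norm_num)
  refine Metric.isCompact_of_isClosed_isBounded ?_ ?_
  · rw [hset]
    simp only [Set.ofPred_and, Set.ofPred_forall]
    refine IsClosed.inter ?_ (IsClosed.inter ?_ (IsClosed.inter ?_ ?_))
    · exact isClosed_iInter fun i => isClosed_eq (by fun_prop) (by fun_prop)
    · exact isClosed_iInter fun i => isClosed_le (by fun_prop) (by fun_prop)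
    · exact isClosed_iInter fun i => isClosed_iInter fun j => isClosed_iInter fun _ =>
        isClosed_eq (by fun_prop) (by fun_prop)
    · exact isClosed_eq (by fun_prop) (by fun_prop)
  · refine (Metric.isBounded_closedBall (x := (0 : ι → V)) (r := ‖(1 : V)‖)).subset fun c hc => ?_
    rw [mem_closedBall_zero_iff, pi_norm_le_iff_of_nonneg (norm_nonneg _)]
    exact fun i => norm_idempotent_le (hc.idem i)

theorem IsCompleteSystem.abs_coeff_le {c : ι → V} (hc : IsCompleteSystem c) (a : ι → ℝ) (i : ι) :
    |a i| ≤ ‖lmulCLM (V := V)‖ * (‖lmulCLM (V := V)‖ * ‖(1 : V)‖ * ‖∑ j, a j • c j‖) := by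
  have h1 := one_le_norm_idempotent (hc.idem i) (hc.ne_zero i)
  have h2 : |a i| * ‖c i‖ ≤ ‖lmulCLM (V := V)‖ * ‖c i‖ * ‖∑ j, a j • c j‖ := by
    have h := norm_mul_le_opNorm (c i) (∑ j, a j • c j)
    rwa [hc.mul_sum_smul, norm_smul, Real.norm_eq_abs] at h
  calc |a i| = |a i| * 1 := (mul_one _).symm
    _ ≤ |a i| * (‖lmulCLM (V := V)‖ * ‖c i‖) := by gcongr
    _ = ‖lmulCLM (V := V)‖ * (|a i| * ‖c i‖) := by ring
    _ ≤ ‖lmulCLM (V := V)‖ * (‖lmulCLM (V := V)‖ * ‖c i‖ * ‖∑ j, a j • c j‖) := by gcongr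
    _ ≤ _ := by
      gcongr
      exact norm_idempotent_le (hc.idem i)

/-- The map `(a, c) ↦ ∑ aᵢ cᵢ` is proper on complete systems: these form a compact set, and the
coefficients are bounded in terms of the sum. -/
theorem isClosed_setOf_sum_smul {C : Set (ι → ℝ)} (hC : IsClosed C) :
    IsClosed {x : V | ∃ a ∈ C, ∃ c : ι → V, IsCompleteSystem c ∧ x = ∑ i, a i • c i} := by
  refine IsSeqClosed.isClosed fun x y hx hxy => ?_
  choose a ha c hc hxac using hx
  obtain ⟨R, hR⟩ := hxy.norm.bddAbove_range
  let M := ‖lmulCLM (V := V)‖ * (‖lmulCLM (V := V)‖ * ‖(1 : V)‖ * R)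
  have hM : ∀ k i, |a k i| ≤ M := fun k i => by
    refine ((hc k).abs_coeff_le (a k) i).trans ?_
    rw [← hxac k]
    have : ‖x k‖ ≤ R := hR ⟨k, rfl⟩
    dsimp only [M]
    gcongr
  have hK : IsCompact ((Set.univ.pi (fun _ : ι => Set.Icc (-M) M)) ×ˢ
      {c : ι → V | IsCompleteSystem c}) :=
    (isCompact_univ_pi fun _ => isCompact_Icc).prod isCompact_setOf_isCompleteSystem
  obtain ⟨⟨a', c'⟩, hmem, φ, hφ, hlim⟩ := hK.tendsto_subseq (x := fun k => (a k, c k))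
    fun k => ⟨fun i _ => abs_le.mp (hM k i), hc k⟩
  have hlima : Tendsto (fun k => a (φ k)) atTop (𝓝 a') :=
    (continuous_fst.tendsto _).comp hlim
  refine ⟨a', hC.mem_of_tendsto hlima (Eventually.of_forall fun k => ha _), c', hmem.2, ?_⟩
  have hcont : Continuous fun p : (ι → ℝ) × (ι → V) => ∑ i, p.1 i • p.2 i := by fun_prop
  refine tendsto_nhds_unique (hxy.comp hφ.tendsto_atTop) ?_
  refine ((hcont.tendsto (a', c')).comp hlim).congr fun k => ?_
  exact (hxac (φ k)).symm

theorem exists_degree_eq_rank : ∃ x : V, degree x = rank V :=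
  Nat.sSup_mem (Set.range_nonempty _) (bddAbove_range_degree V)

theorem analyticAt_jpow {f : ℝ → V} {t : ℝ} (hf : AnalyticAt ℝ f t) (k : ℕ) :
    AnalyticAt ℝ (fun s => jpow (f s) k) t := by
  induction k with
  | zero => exact analyticAt_const
  | succ k ih =>
    exact ((lmulCLM (V := V)).analyticAt_bilinear _).comp₂ hf ih

/-- Elements of maximal degree are dense: on the line through `x` and such an element, the Gram
determinant of `1, x, …, xⁿ⁻¹` is analytic and not identically zero. -/
theorem dense_setOf_degree_eq_rank : Dense {x : V | degree x = rank V} := by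
  intro x
  obtain ⟨y, hy⟩ := exists_degree_eq_rank (V := V)
  let g : ℝ → V := fun s => x + s • (y - x)
  let D : ℝ → ℝ := fun s => (Matrix.gram ℝ fun i : Fin (rank V) => jpow (g s) i).det
  have hg : ∀ s, AnalyticAt ℝ g s := fun s =>
    analyticAt_const.add (analyticAt_id.smul analyticAt_const)
  have hD : AnalyticOnNhd ℝ D Set.univ := by
    have hentry : ∀ i j : Fin (rank V), AnalyticOnNhd ℝ
        (fun s => Matrix.gram ℝ (fun i : Fin (rank V) => jpow (g s) i) i j) Set.univ := by
      intro i j s _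
      exact ((innerSL ℝ (E := V)).analyticAt_bilinear _).comp₂ (analyticAt_jpow (hg s) i)
        (analyticAt_jpow (hg s) j)
    simp only [D, Matrix.det_apply']
    refine Finset.analyticOnNhd_fun_sum _ fun σ _ => analyticOnNhd_const.mul ?_
    exact Finset.analyticOnNhd_fun_prod _ fun i _ => hentry _ _
  have hD1 : D 1 ≠ 0 := by
    have : g 1 = y := by simp [g]
    simp only [D, this]
    exact Matrix.det_gram_ne_zero_iff_linearIndependent.mpr
      (linearIndependent_jpow_of_le_degree hy.ge)
  have hne : ∀ᶠ s in 𝓝[≠] (0 : ℝ), D s ≠ 0 := by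
    by_contra h
    exact hD1 (hD.eqOn_zero_of_preconnected_of_frequently_eq_zero isPreconnected_univ
      (Set.mem_univ 0) (by simpa only [not_eventually, not_not] using h) (Set.mem_univ 1))
  have hlim : Tendsto g (𝓝[≠] 0) (𝓝 x) := by
    have h := (hg 0).continuousAt.tendsto
    have h0 : g 0 = x := by simp [g]
    rw [h0] at h
    exact h.mono_left nhdsWithin_le_nhds
  refine mem_closure_of_tendsto hlim (hne.mono fun s hs => ?_)
  exact le_antisymm (degree_le_rank _)
    (le_degree (Matrix.det_gram_ne_zero_iff_linearIndependent.mp hs))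

/-- The elements diagonalised by a complete system of `rank V` idempotents form a closed set that
contains the dense set of elements of maximal degree. -/
theorem exists_isCompleteSystem_rank (x : V) :
    ∃ (a : Fin (rank V) → ℝ) (e : Fin (rank V) → V),
      IsCompleteSystem e ∧ x = ∑ i, a i • e i := by
  have hcl := isClosed_setOf_sum_smul (V := V) (ι := Fin (rank V)) isClosed_univ
  have hx : x ∈ closure {x : V | degree x = rank V} := dense_setOf_degree_eq_rank x
  have := closure_minimal (fun y hy => ?_) hcl hx
  · obtain ⟨a, -, h⟩ := this
    exact ⟨a, h⟩
  · obtain ⟨a, h⟩ := exists_isCompleteSystem_of_degree_eq hy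
    exact ⟨a, Set.mem_univ _, h⟩

/-- The spectral theorem: every element has a vector of eigenvalues in decreasing order. -/
theorem exists_isEigenvalueVector (x : V) : ∃ q, IsEigenvalueVector x q := by
  obtain ⟨a, e, he, hx⟩ := exists_isCompleteSystem_rank x
  let σ := Tuple.sort fun i => -a i
  refine ⟨WithLp.toLp 2 (a ∘ σ), fun i j hij => ?_, e ∘ σ, (he.comp_equiv σ).isJordanFrame, ?_⟩
  · have := Tuple.monotone_sort (fun i => -a i) hij
    simpa using this
  · exact hx.trans (Equiv.sum_comp σ fun i => a i • e i).symm

end Existence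

/-! ### Uniqueness and continuity of the eigenvalues -/

section Uniqueness

variable {V : Type*} [EuclideanJordanAlgebra V]

/-- The sum of the idempotents belonging to a given eigenvalue depends on the element only, being a
polynomial in it. -/
theorem IsCompleteSystem.sum_filter_eq {ι : Type*} [Fintype ι] {e f : ι → V}
    (he : IsCompleteSystem e) (hf : IsCompleteSystem f) {a b : ι → ℝ}
    (h : ∑ i, a i • e i = ∑ i, b i • f i) (t : ℝ) :
    ∑ i with a i = t, e i = ∑ i with b i = t, f i := by
  classical
  let S : Finset ℝ := insert t (Finset.univ.image a ∪ Finset.univ.image b)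
  let p := Lagrange.basis S (id : ℝ → ℝ) t
  have hp : ∀ u ∈ S, p.eval u = if u = t then 1 else 0 := by
    intro u hu
    split_ifs with hut
    · subst hut
      exact Lagrange.eval_basis_self (v := (id : ℝ → ℝ)) Function.injective_id.injOn hu
    · exact Lagrange.eval_basis_of_ne (v := (id : ℝ → ℝ)) (Ne.symm hut) hu
  have key := congrArg (fun x => polyEval x p) h
  simp only [he.polyEval_sum, hf.polyEval_sum] at key
  rw [Finset.sum_filter, Finset.sum_filter]
  convert key using 2 with i _ i _
  · rw [hp (a i) (by simp [S])]
    split_ifs <;> simp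
  · rw [hp (b i) (by simp [S])]
    split_ifs <;> simp

theorem IsEigenvalueVector.unique {x : V} {q r : EuclideanSpace ℝ (Fin (rank V))}
    (hq : IsEigenvalueVector x q) (hr : IsEigenvalueVector x r) : q = r := by
  obtain ⟨hq, e, he, hx⟩ := hq
  obtain ⟨hr, f, hf, hx'⟩ := hr
  have he := he.isCompleteSystem
  have hf := hf.isCompleteSystem
  have hsum := he.sum_filter_eq hf (a := q) (b := r) (hx.symm.trans hx')
  have hfib : ∀ t, Nonempty ({i // q i = t} ≃ {i // r i = t}) := by
    intro t
    refine ⟨Fintype.equivOfCardEq ?_⟩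
    rw [Fintype.card_subtype, Fintype.card_subtype]
    exact le_antisymm (card_le_card_of_sum_eq hf he (hsum t).symm)
      (card_le_card_of_sum_eq he hf (hsum t))
  let σ : Equiv.Perm (Fin (rank V)) := Equiv.ofFiberEquiv fun t => (hfib t).some
  have hσ : ∀ i, r (σ i) = q i := Equiv.ofFiberEquiv_map _
  have := Tuple.unique_monotone (f := fun i => -r i) (σ := σ) (τ := Equiv.refl _)
    (fun i j hij => by simpa [hσ] using hq i j hij) (fun i j hij => by simpa using hr i j hij)
  ext i
  have hi := congrFun this i
  simpa [hσ] using hi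

theorem isEigenvalueVector_eigenvalueMap (x : V) : IsEigenvalueVector x (eigenvalueMap x) := by
  have h := exists_isEigenvalueVector x
  rw [eigenvalueMap, dif_pos h]
  exact h.choose_spec

theorem IsEigenvalueVector.eigenvalueMap_eq {x : V} {q : EuclideanSpace ℝ (Fin (rank V))}
    (hq : IsEigenvalueVector x q) : eigenvalueMap x = q :=
  (isEigenvalueVector_eigenvalueMap x).unique hq

/-- The preimage of a closed set `C` consists of the sums `∑ aᵢ eᵢ` with `a ∈ C` decreasing and `e` a
Jordan frame, hence is closed. -/
theorem continuous_eigenvalueMap :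
    Continuous (eigenvalueMap : V → EuclideanSpace ℝ (Fin (rank V))) := by
  refine continuous_iff_isClosed.mpr fun C hC => ?_
  have hD : IsClosed {a : Fin (rank V) → ℝ | WithLp.toLp 2 a ∈ C ∧ ∀ i j, i ≤ j → a j ≤ a i} := by
    simp only [Set.ofPred_and, Set.ofPred_forall]
    refine (hC.preimage (PiLp.continuous_toLp 2 _)).inter ?_
    exact isClosed_iInter fun i => isClosed_iInter fun j => isClosed_iInter fun _ =>
      isClosed_le (by fun_prop) (by fun_prop)
  convert isClosed_setOf_sum_smul (V := V) hD using 1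
  ext x
  constructor
  · intro hx
    obtain ⟨h1, e, he, h2⟩ := isEigenvalueVector_eigenvalueMap x
    exact ⟨(eigenvalueMap x).ofLp, ⟨hx, h1⟩, e, he.isCompleteSystem, h2⟩
  · rintro ⟨a, ⟨haC, ha⟩, e, he, hx⟩
    have : IsEigenvalueVector x (WithLp.toLp 2 a) := ⟨ha, e, he.isJordanFrame, hx⟩
    rw [Set.mem_preimage, this.eigenvalueMap_eq]
    exact haC

/-- Every decreasing vector is attained, along any fixed Jordan frame. -/
theorem exists_eigenvalueMap_eq {q : EuclideanSpace ℝ (Fin (rank V))}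
    (hq : ∀ i j, i ≤ j → q j ≤ q i) : ∃ x : V, eigenvalueMap x = q := by
  obtain ⟨-, e, he, -⟩ := isEigenvalueVector_eigenvalueMap (1 : V)
  exact ⟨∑ i, q i • e i, IsEigenvalueVector.eigenvalueMap_eq ⟨hq, e, he, rfl⟩⟩

end Uniqueness

end EuclideanJordanAlgebra

/-! ### Decreasing rearrangements and the image of the eigenvalue map -/

theorem decreasingRearrangement_eq_self {n : ℕ} {q : EuclideanSpace ℝ (Fin n)}
    (hq : ∀ i j, i ≤ j → q j ≤ q i) : decreasingRearrangement q = q := by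
  have := Tuple.unique_monotone (f := fun i => -q i) (σ := Tuple.sort fun i => -q i)
    (τ := Equiv.refl _) (Tuple.monotone_sort _) (fun i j hij => by simpa using hq i j hij)
  ext i
  have hi := congrFun this i
  simpa [decreasingRearrangement, permuteVec] using hi

theorem mem_inter_decreasingSet_iff {n : ℕ} {P : Set (EuclideanSpace ℝ (Fin n))}
    {q : EuclideanSpace ℝ (Fin n)} :
    q ∈ P ∩ decreasingSet P ↔ q ∈ P ∧ ∀ i j, i ≤ j → q j ≤ q i := by
  refine and_congr_right fun hq => ⟨?_, fun h => ⟨q, hq, decreasingRearrangement_eq_self h⟩⟩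
  rintro ⟨p, -, rfl⟩
  exact decreasingRearrangement_antitone p

theorem IsPermutationInvariant.decreasingSet_subset {n : ℕ} {Q : Set (EuclideanSpace ℝ (Fin n))}
    (hQ : IsPermutationInvariant Q) : decreasingSet Q ⊆ Q := by
  rintro _ ⟨q, hq, rfl⟩
  rw [← hQ.2 (Tuple.sort fun i => -q i)]
  exact ⟨q, hq, rfl⟩

theorem IsArcwiseConnected.image {X Y : Type*} [TopologicalSpace X] [TopologicalSpace Y]
    {S : Set X} (hS : IsArcwiseConnected S) {f : X → Y} (hf : Continuous f) :
    IsArcwiseConnected (f '' S) := by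
  rintro _ ⟨x, hx, rfl⟩ _ ⟨y, hy, rfl⟩
  exact (hS x hx y hy).map hf

theorem EuclideanJordanAlgebra.image_preimage_eigenvalueMap {V : Type*} [EuclideanJordanAlgebra V]
    (P : Set (EuclideanSpace ℝ (Fin (rank V)))) :
    (eigenvalueMap : V → _) '' ((eigenvalueMap : V → _) ⁻¹' P) = P ∩ decreasingSet P := by
  ext q
  rw [mem_inter_decreasingSet_iff, Set.image_preimage_eq_inter_range]
  refine and_congr_right fun _ => ⟨?_, exists_eigenvalueMap_eq⟩
  rintro ⟨x, rfl⟩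
  exact (isEigenvalueVector_eigenvalueMap x).1

theorem mainTheorem6 {V : Type*} [EuclideanJordanAlgebra V] :
    (∀ P : Set (EuclideanSpace ℝ (Fin (EuclideanJordanAlgebra.rank V))),
      (IsPreconnected ((EuclideanJordanAlgebra.eigenvalueMap : V → _) ⁻¹' P) →
        IsPreconnected (P ∩ decreasingSet P)) ∧
      (IsArcwiseConnected ((EuclideanJordanAlgebra.eigenvalueMap : V → _) ⁻¹' P) →
        IsArcwiseConnected (P ∩ decreasingSet P))) ∧
    (∀ Q : Set (EuclideanSpace ℝ (Fin (EuclideanJordanAlgebra.rank V))),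
      IsPermutationInvariant Q →
      (IsPreconnected ((EuclideanJordanAlgebra.eigenvalueMap : V → _) ⁻¹' Q) →
        IsPreconnected (decreasingSet Q)) ∧
      (IsArcwiseConnected ((EuclideanJordanAlgebra.eigenvalueMap : V → _) ⁻¹' Q) →
        IsArcwiseConnected (decreasingSet Q))) := by
  have hcont := EuclideanJordanAlgebra.continuous_eigenvalueMap (V := V)
  have main : ∀ P : Set (EuclideanSpace ℝ (Fin (EuclideanJordanAlgebra.rank V))),
      (IsPreconnected ((EuclideanJordanAlgebra.eigenvalueMap : V → _) ⁻¹' P) →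
        IsPreconnected (P ∩ decreasingSet P)) ∧
      (IsArcwiseConnected ((EuclideanJordanAlgebra.eigenvalueMap : V → _) ⁻¹' P) →
        IsArcwiseConnected (P ∩ decreasingSet P)) := by
    intro P
    rw [← EuclideanJordanAlgebra.image_preimage_eigenvalueMap (V := V) P]
    exact ⟨fun h => h.image _ hcont.continuousOn, fun h => h.image hcont⟩
  refine ⟨main, fun Q hQ => ?_⟩
  have h := main Q
  rwa [Set.inter_eq_right.mpr hQ.decreasingSet_subset] at h
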